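/- Threshold testing: a distribution $F$ on $\mathbb{R}_{\ge 0}$ with finite expectation is given, and boxes $1,\dots,n$ contain hidden i.i.d. values $X_1,\dots,X_n\sim F$. An adaptive testing algorithm tests each box $i$ exactly once, in the order $1,\dots,n$: it picks a threshold $t_i\ge 0$, which may depend on the earlier answers, and only learns whether $X_i\ge t_i$ (a positive test) or not. After all $n$ tests it chooses a box $\sigma$ on the basis of the answers. It is $c$-competitive for $F$ if $\mathbb{E}[X_\sigma]\ge c\cdot\mathbb{E}[\max_i X_i]$. Theorem. There are a program for a register machine over the reals (unit-cost arithmetic and comparisons, rational constants, input $n$, queries to the quantile function $F^{-1}(p)=\inf\{x\ge 0 : F(x)\ge p\}$, access to the boxes only through tests), a constant $C$, and a sequence $\varepsilon_n\to 0$, the program, $C$ and $\varepsilon$ being independent of $F$ and the program and $C$ also of $n$, such that for every $n\ge 1$ and every distribution $F$ on $\mathbb{R}_{\ge 0}$ with finite expectation and continuous distribution function the following holds. On $n$ boxes with distribution $F$ the program carries out a testing algorithm, in at most $C n$ steps for all contents of the boxes, and this algorithm is $(0.869-\varepsilon_n)$-competitive for $F$. Moreover, for $n\ge 3$ the algorithm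 is the following one, with $k=3$ and $(\alpha_1,\alpha_2,\alpha_3)=(2.035135,\,0.5063,\,0.05701)$: as long as $j<k$ tests have been positive, the next box is tested with threshold $F^{-1}(1-\alpha_{j+1}/n)$ (once $k$ tests have been positive, the remaining tests are arbitrary); at the end it chooses the box that tested positively for $F^{-1}(1-\alpha_j/n)$ with the largest such $j\le k$, and an arbitrary box if all tests were negative. -/

import Mathlib

open MeasureTheory ProbabilityTheory Filter Topology

universe u

noncomputable section

namespace ThresholdTesting

/-! ### Testing algorithms -/

/-- A (deterministic, adaptive) testing algorithm for `n` boxes, numbered `0, …, n - 1`. The boxes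
are tested once each, in this order. Everything the algorithm learns is the list of answers so far
(oldest first, `true` for a positive test): `threshold h` is the threshold of the next test after
the answers `h`, and `choice h` is the box taken after all `n` answers `h`. -/
structure TestingAlgorithm (n : ℕ) where
  threshold : List Bool → ℝ
  threshold_nonneg : ∀ h, 0 ≤ threshold h
  choice : List Bool → Fin n

open Classical in
/-- The answers to the first `i` tests if box `j` contains `x j`; a test with threshold `t` of a box
with value `v` is positive iff `t ≤ v`. -/
def TestingAlgorithm.history {n : ℕ} (A : TestingAlgorithm n) (x : Fin n → ℝ) : ℕ → List Bool
  | 0 => []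
  | i + 1 =>
    if hi : i < n then
      A.history x i ++ [decide (A.threshold (A.history x i) ≤ x ⟨i, hi⟩)]
    else A.history x i

/-- The list of thresholds used for the boxes `0, …, n - 1`. -/
def TestingAlgorithm.thresholds {n : ℕ} (A : TestingAlgorithm n) (x : Fin n → ℝ) : List ℝ :=
  (List.range n).map fun i => A.threshold (A.history x i)

/-- The box `σ` that is finally chosen. -/
def TestingAlgorithm.selected {n : ℕ} (A : TestingAlgorithm n) (x : Fin n → ℝ) : Fin n :=
  A.choice (A.history x n)

/-- `A` is `c`-competitive for the distribution `μ`: for all i.i.d. `X i` with law `μ`, the reward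
`X σ` has finite expectation and `E[X σ] ≥ c * E[max i, X i]`. -/
def TestingAlgorithm.IsCompetitive {n : ℕ} (A : TestingAlgorithm n) (μ : Measure ℝ) (c : ℝ) :
    Prop :=
  ∀ (Ω : Type u) [MeasurableSpace Ω] (ν : Measure Ω) [IsProbabilityMeasure ν]
    (X : Fin n → Ω → ℝ), (∀ i, Measurable (X i)) → iIndepFun X ν → (∀ i, ν.map (X i) = μ) →
    Integrable (fun ω => X (A.selected fun i => X i ω) ω) ν ∧
      c * ∫ ω, (⨆ i, X i ω) ∂ν ≤ ∫ ω, X (A.selected fun i => X i ω) ω ∂ν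

/-! ### Quantile testing -/

/-- The quantile function `F⁻¹ p = inf {x ≥ 0 | p ≤ F x}` of a distribution on the nonnegative
reals with distribution function `F`. -/
def quantile (μ : Measure ℝ) (p : ℝ) : ℝ :=
  sInf {x : ℝ | 0 ≤ x ∧ p ≤ cdf μ x}

/-- `A` tests with the `k` quantile thresholds `F⁻¹ (1 - α j / n)`, starting with `j = 0` and moving
on to the next one after each positive test (once all `k` have been tested positively, the remaining
tests are arbitrary). It chooses the box that tested positively for the last of these `k` thresholds
for which there was a positive test, and an arbitrary box if all tests were negative. -/
structure TestingAlgorithm.IsQuantileTesting {n k : ℕ} (A : TestingAlgorithm n) (μ : Measure ℝ)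
    (α : Fin k → ℝ) : Prop where
  threshold_eq : ∀ h : List Bool, h.length < n → ∀ hk : h.count true < k,
    A.threshold h = quantile μ (1 - α ⟨h.count true, hk⟩ / n)
  choice_eq : ∀ h : List Bool, h.length = n → ∀ i : Fin n, h[(i : ℕ)]? = some true →
    (h.take (i + 1)).count true = min k (h.count true) → A.choice h = i

/-! ### Machine model

A register machine over the reals with unit-cost arithmetic and comparisons, which may query the
quantile function of the distribution and which can access the boxes only through tests. -/

/-- Instructions; `d`, `a`, `b` are numbers of registers and `l` is the number of an instruction. -/
inductive Instr where
  /-- `R d := c` -/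
  | const (d : ℕ) (c : ℚ)
  /-- `R d := R a + R b` -/
  | add (d a b : ℕ)
  /-- `R d := R a - R b` -/
  | sub (d a b : ℕ)
  /-- `R d := R a * R b` -/
  | mul (d a b : ℕ)
  /-- `R d := R a / R b`, provided that `R b ≠ 0` -/
  | div (d a b : ℕ)
  /-- go to instruction `l` if `R a < R b`, and to the next one otherwise -/
  | jumpLT (a b l : ℕ)
  /-- `R d := F⁻¹ (R a)` -/
  | quantile (d a : ℕ)
  /-- test the next box with threshold `R a`; `R d := 1` if positive and `R d := 0` if negative -/
  | test (d a : ℕ)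
  /-- stop and choose the box with number `R a` -/
  | halt (a : ℕ)

/-- A program is a finite list of instructions. -/
abbrev Program := List Instr

/-- Configurations: the program counter, the registers and the list of the thresholds of the tests
made so far (oldest first), so that the next box to be tested has the number `log.length`. -/
structure Config where
  pc : ℕ
  reg : ℕ → ℝ
  log : List ℝ

/-- Write `v` to register `d` and go to the next instruction. -/
def Config.write (s : Config) (d : ℕ) (v : ℝ) : Config :=
  { s with pc := s.pc + 1, reg := Function.update s.reg d v }

/-- The start: register `0` holds the number `n` of boxes, the others hold `0`. -/
def Config.init (n : ℕ) : Config where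
  pc := 0
  reg := fun r => if r = 0 then (n : ℝ) else 0
  log := []

open Classical in
/-- The effect of an instruction that does not stop the machine; `none` means that it fails. `Q` is
the quantile function that answers the queries and `x` are the contents of the boxes. -/
def step {n : ℕ} (Q : ℝ → ℝ) (x : Fin n → ℝ) (s : Config) : Instr → Option Config
  | .const d c => some (s.write d (c : ℝ))
  | .add d a b => some (s.write d (s.reg a + s.reg b))
  | .sub d a b => some (s.write d (s.reg a - s.reg b))
  | .mul d a b => some (s.write d (s.reg a * s.reg b))
  | .div d a b => if s.reg b = 0 then none else some (s.write d (s.reg a / s.reg b))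
  | .jumpLT a b l => some { s with pc := if s.reg a < s.reg b then l else s.pc + 1 }
  | .quantile d a => some (s.write d (Q (s.reg a)))
  | .test d a =>
    if h : s.log.length < n then
      some { s.write d (if s.reg a ≤ x ⟨s.log.length, h⟩ then 1 else 0) with
        log := s.log ++ [s.reg a] }
    else none
  | .halt _ => none

/-- Run `P` for at most `T` steps, each instruction (also a query, a test or the final `halt`)
counting as one step. If it stops in this time, the result is the number of the chosen box and the
list of the thresholds of the tests; otherwise it is `none`. -/
def exec {n : ℕ} (P : Program) (Q : ℝ → ℝ) (x : Fin n → ℝ) : ℕ → Config → Option (ℝ × List ℝ)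
  | 0, _ => none
  | T + 1, s =>
    match P[s.pc]? with
    | none => none
    | some (.halt a) => some (s.reg a, s.log)
    | some I => (step Q x s I).bind (exec P Q x T)

/-- Given `n` and access to the quantile function of `μ`, the program `P` carries out the testing
algorithm `A` in at most `T` steps, whatever the contents of the boxes: it tests each box exactly
once with the threshold of `A` and chooses the same box as `A`. -/
def Program.Implements {n : ℕ} (P : Program) (μ : Measure ℝ) (A : TestingAlgorithm n) (T : ℕ) :
    Prop :=
  ∀ x : Fin n → ℝ, exec P (quantile μ) x T (Config.init n) =
    some (((A.selected x : ℕ) : ℝ), A.thresholds x)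

end ThresholdTesting

end

open ThresholdTesting

/-! The ratio follows by comparing tails: if P(X_σ ≥ t) ≥ c P(max ≥ t) for all t, integration over t
gives c-competitiveness (`mul_integral_le_of_forall_real`). Fix t and put q = P(X ≥ t), l = nq.

Since F is continuous, the j-th threshold is passed with probability exactly α_j/n
(`real_Ici_quantile`). Let w_j be the probability that exactly j boxes are accepted. The course of
the tests depends on an accepted value only through its passing the threshold, so given j the last
accepted value has the law of X conditioned on passing the j-th threshold
(`IsIIDUpTo.real_processEvent_mul`). Hence P(X_σ ≥ t) ≥ ∑ w_j min(1, l/α_j), where the case without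
an accepted box is thrown away. The w_j satisfy linear recurrences whose solutions are combinations
of the powers (1 - α_j/n)^n; their limits are evaluated in `limit_probabilities_bounds`.

On the other side P(max ≥ t) ≤ 1 - (1 - q)^n ≤ (1 + 2/n)(1 - e^{-l}). What remains is an inequality
in l alone, `one_sub_exp_neg_le_sum_min`. It holds with 0.8692, and the gap to 0.869 absorbs the
factor 1 + 2/n for large n. For the finitely many other n, the loss ε_n = 0.869 leaves nothing to
prove.

That the machine carries out this algorithm is a loop invariant (`exec_loop`). -/

noncomputable section

namespace ThresholdTesting

/-! ### The box that was accepted last -/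

/-- One step of the scan of a list of answers: the state consists of the number of answers read,
the number of accepted positive answers (at most `k`) and the position of the last accepted one. -/
def scanStep (k : ℕ) (s : ℕ × ℕ × ℕ) (b : Bool) : ℕ × ℕ × ℕ :=
  if b = true ∧ s.2.1 < k then (s.1 + 1, s.2.1 + 1, s.1) else (s.1 + 1, s.2.1, s.2.2)

/-- The result of the scan of a list of answers. -/
def scan (k : ℕ) (h : List Bool) : ℕ × ℕ × ℕ :=
  h.foldl (scanStep k) (0, 0, 0)

/-- The position of the `min k (h.count true)`-th positive answer in `h`, and `0` if there is
none. -/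
def acceptedIndex (k : ℕ) (h : List Bool) : ℕ :=
  (scan k h).2.2

theorem scan_concat (k : ℕ) (h : List Bool) (b : Bool) :
    scan k (h ++ [b]) = scanStep k (scan k h) b := by
  simp [scan]

theorem scan_counts (k : ℕ) (h : List Bool) :
    (scan k h).1 = h.length ∧ (scan k h).2.1 = min k (h.count true) := by
  induction h using List.reverseRecOn with
  | nil => simp [scan]
  | append_singleton l b ih =>
    rw [scan_concat, scanStep, ih.1, ih.2]
    cases b
    · simp
    · simp only [true_and, List.length_append, List.length_singleton, List.count_append,
        List.count_singleton_self]
      split_ifs <;> simp only [true_and] <;> omega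

theorem acceptedIndex_concat (k : ℕ) (h : List Bool) (b : Bool) :
    acceptedIndex k (h ++ [b]) =
      if b = true ∧ h.count true < k then h.length else acceptedIndex k h := by
  rw [acceptedIndex, scan_concat, scanStep, (scan_counts k h).1, (scan_counts k h).2]
  have : min k (h.count true) < k ↔ h.count true < k := by omega
  simp only [this]
  split_ifs <;> rfl

theorem acceptedIndex_eq (k : ℕ) (h : List Bool) (i : ℕ) (hi : h[i]? = some true)
    (hc : (h.take (i + 1)).count true = min k (h.count true)) : acceptedIndex k h = i := by
  induction h using List.reverseRecOn with
  | nil => simp at hi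
  | append_singleton l b ih =>
    rw [acceptedIndex_concat]
    rcases lt_trichotomy i l.length with hlt | heq | hgt
    · rw [List.getElem?_append_left hlt] at hi
      rw [List.take_append_of_le_length (by omega)] at hc
      have hle : (l.take (i + 1)).count true ≤ l.count true :=
        (List.take_sublist _ _).count_le _
      cases b
      · simp only [Bool.false_eq_true, false_and, if_false]
        apply ih hi
        simpa using hc
      · simp only [List.count_append, List.count_singleton_self] at hc
        -- If the last answer were accepted too, `hc` would ask a prefix of `l` for more positive
        -- answers than `l` has.
        rw [if_neg (by rintro ⟨-, h2⟩; omega)]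
        apply ih hi
        by_cases hk : l.count true < k
        · omega
        · omega
    · subst heq
      have hb : b = true := by simpa using hi
      subst hb
      rw [if_pos]
      rw [List.take_of_length_le (by simp)] at hc
      simp only [List.count_append, List.count_singleton_self] at hc
      exact ⟨rfl, by omega⟩
    · rw [List.getElem?_eq_none (by simp; omega)] at hi
      simp at hi

/-! ### The algorithm that moves through a sequence of thresholds -/

/-- The algorithm that tests with `τ j` after `j` positive answers, and which accepts the first
`k` boxes with a positive test and chooses the last accepted one. -/
def sequentialTesting (k n : ℕ) [NeZero n] (τ : ℕ → ℝ) (hτ : ∀ j, 0 ≤ τ j) :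
    TestingAlgorithm n where
  threshold h := τ (h.count true)
  threshold_nonneg _ := hτ _
  choice h := Fin.ofNat n (acceptedIndex k h)

theorem TestingAlgorithm.length_history {n : ℕ} (A : TestingAlgorithm n) (x : Fin n → ℝ)
    {i : ℕ} (hi : i ≤ n) : (A.history x i).length = i := by
  induction i with
  | zero => rfl
  | succ i ih => rw [history, dif_pos (by omega)]; simp [ih (by omega)]

theorem acceptedIndex_lt_length (k : ℕ) (h : List Bool) (hh : h ≠ []) :
    acceptedIndex k h < h.length := by
  induction h using List.reverseRecOn with
  | nil => exact absurd rfl hh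
  | append_singleton l b ih =>
    rw [acceptedIndex_concat]
    split_ifs
    · simp
    · rcases eq_or_ne l [] with rfl | hl
      · simp [acceptedIndex, scan]
      · have := ih hl
        simp; omega

section

variable {k n : ℕ} [NeZero n] {τ : ℕ → ℝ} {hτ : ∀ j, 0 ≤ τ j}

theorem val_selected_sequentialTesting (x : Fin n → ℝ) :
    (((sequentialTesting k n τ hτ).selected x : Fin n) : ℕ) =
      acceptedIndex k ((sequentialTesting k n τ hτ).history x n) := by
  have hl := (sequentialTesting k n τ hτ).length_history x le_rfl
  have hne : (sequentialTesting k n τ hτ).history x n ≠ [] := by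
    intro h0
    rw [h0] at hl
    exact NeZero.ne n hl.symm
  have := acceptedIndex_lt_length k _ hne
  rw [hl] at this
  exact Nat.mod_eq_of_lt this

theorem isQuantileTesting_sequentialTesting (μ : Measure ℝ) (α : Fin k → ℝ)
    (h : ∀ j (hj : j < k), τ j = quantile μ (1 - α ⟨j, hj⟩ / n)) :
    (sequentialTesting k n τ hτ).IsQuantileTesting μ α where
  threshold_eq l _ hk := h _ hk
  choice_eq l hl i hi hc := by
    apply Fin.ext
    change acceptedIndex k l % n = i
    rw [acceptedIndex_eq k l i hi hc]
    exact Nat.mod_eq_of_lt i.2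

/-- The number of accepted boxes and the value in the last one after `i` tests of boxes with
contents `y`. -/
def process (k : ℕ) (τ : ℕ → ℝ) (y : ℕ → ℝ) : ℕ → ℕ × ℝ
  | 0 => (0, 0)
  | i + 1 =>
    open Classical in
    if (process k τ y i).1 < k ∧ τ (process k τ y i).1 ≤ y i then
      ((process k τ y i).1 + 1, y i)
    else process k τ y i

/-- Replaces lists of answers by a Markov chain for the probabilistic part. The values must be
compared only after an acceptance, since before it the chain holds the dummy value 0 and the index
is the dummy position 0. -/
theorem process_eq_history (x : Fin n → ℝ) (y : ℕ → ℝ) (hy : ∀ i : Fin n, y i = x i) {i : ℕ}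
    (hi : i ≤ n) :
    (process k τ y i).1 = min k (((sequentialTesting k n τ hτ).history x i).count true) ∧
      (0 < (process k τ y i).1 → (process k τ y i).2 =
        y (acceptedIndex k ((sequentialTesting k n τ hτ).history x i))) := by
  induction i with
  | zero => simp [process, TestingAlgorithm.history]
  | succ i ih =>
    obtain ⟨ih1, ih2⟩ := ih (by omega)
    have hl := (sequentialTesting k n τ hτ).length_history x (i := i) (by omega)
    rw [TestingAlgorithm.history, dif_pos (by omega), acceptedIndex_concat, hl, process]
    have hyi : x ⟨i, by omega⟩ = y i := (hy ⟨i, by omega⟩).symm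
    have ht : ∀ h, (sequentialTesting k n τ hτ).threshold h = τ (h.count true) := fun _ => rfl
    rw [hyi, ht]
    by_cases hk : ((sequentialTesting k n τ hτ).history x i).count true < k
    · rw [min_eq_right hk.le] at ih1
      rw [ih1] at ih2 ⊢
      by_cases hτy : τ (((sequentialTesting k n τ hτ).history x i).count true) ≤ y i
      · simp [hk, hτy]
      · simpa [hk, hτy, ih1, hk.le] using ih2
    · rw [min_eq_left (by omega)] at ih1
      simp only [ih1, hk, lt_irrefl, false_and, and_false, if_false]
      rw [ih1] at ih2
      refine ⟨?_, ih2⟩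
      simp; omega

theorem process_snd_eq_selected (x : Fin n → ℝ) (y : ℕ → ℝ) (hy : ∀ i : Fin n, y i = x i)
    (hpos : 0 < (process k τ y n).1) :
    (process k τ y n).2 = x ((sequentialTesting k n τ hτ).selected x) := by
  rw [(process_eq_history (hτ := hτ) x y hy le_rfl).2 hpos, ← hy, val_selected_sequentialTesting]

end

/-! ### The program -/

/-- The program for three thresholds `F⁻¹ (1 - a / n)`, `F⁻¹ (1 - b / n)`, `F⁻¹ (1 - c / n)`. -/
def threeThresholds (a b c : ℚ) : Program :=
  -- Registers: 0 is n, 1 the number of tests made, 2 the last accepted box, 3 the current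
  -- threshold, 4 and 5 the following ones, 7 the answer, 8 scratch, 9 the number of acceptances
  -- left, 10 and 11 the constants 1 and 0. The loop starts at 14, the increment at 18 and the
  -- acceptance at 22; `jumpLT 11 10` is an unconditional jump.
  [ .const 10 1, .const 9 3,
    .const 8 a, .div 8 8 0, .sub 8 10 8, .quantile 3 8,
    .const 8 b, .div 8 8 0, .sub 8 10 8, .quantile 4 8,
    .const 8 c, .div 8 8 0, .sub 8 10 8, .quantile 5 8,
    .jumpLT 1 0 16,
    .halt 2,
    .test 7 3,
    .jumpLT 11 7 20,
    .add 1 1 10,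
    .jumpLT 11 10 14,
    .jumpLT 11 9 22,
    .jumpLT 11 10 18,
    .add 2 1 11,
    .sub 9 9 10,
    .add 3 4 11,
    .add 4 5 11,
    .jumpLT 11 10 18 ]

section

variable {n : ℕ} {P : Program} {Q : ℝ → ℝ} {x : Fin n → ℝ}

theorem exec_mono {T T' : ℕ} (h : T ≤ T') {s : Config} {r : ℝ × List ℝ}
    (hr : exec P Q x T s = some r) : exec P Q x T' s = some r := by
  induction T generalizing T' s with
  | zero => simp [exec] at hr
  | succ T ih =>
    obtain ⟨T', rfl⟩ : ∃ m, T' = m + 1 := ⟨T' - 1, by omega⟩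
    rw [exec] at hr ⊢
    split at hr
    · simp at hr
    · exact hr
    · rename_i I hI1 hI2
      rw [Option.bind_eq_some_iff] at hr ⊢
      obtain ⟨s', hs', h2⟩ := hr
      exact ⟨s', hs', ih (by omega) h2⟩

variable [NeZero n] {τ : ℕ → ℝ} {hτ : ∀ j, 0 ≤ τ j}

/-- The state of the machine before the test of box `i`. -/
structure LoopInvariant (τ : ℕ → ℝ) (hτ : ∀ j, 0 ≤ τ j) (x : Fin n → ℝ) (i : ℕ) (s : Config) :
    Prop where
  pc : s.pc = 14
  r0 : s.reg 0 = n
  r1 : s.reg 1 = i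
  r2 : s.reg 2 = acceptedIndex 3 ((sequentialTesting 3 n τ hτ).history x i)
  r3 : s.reg 3 = τ (((sequentialTesting 3 n τ hτ).history x i).count true)
  r4 : s.reg 4 = τ (((sequentialTesting 3 n τ hτ).history x i).count true + 1)
  r5 : s.reg 5 = τ 2
  r9 : s.reg 9 = 3 - (min 3 (((sequentialTesting 3 n τ hτ).history x i).count true) : ℕ)
  r10 : s.reg 10 = 1
  r11 : s.reg 11 = 0
  log : s.log = (List.range i).map fun j =>
    (sequentialTesting 3 n τ hτ).threshold ((sequentialTesting 3 n τ hτ).history x j)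

set_option maxHeartbeats 1000000 in
theorem exec_loop {a b c : ℚ} (hτ2 : ∀ j, 2 ≤ j → τ j = τ 2) (m i : ℕ) (hi : i + m = n)
    (s : Config) (hs : LoopInvariant τ hτ x i s) :
    exec (threeThresholds a b c) Q x (11 * m + 2) s =
      some ((((sequentialTesting 3 n τ hτ).selected x : ℕ) : ℝ),
        (sequentialTesting 3 n τ hτ).thresholds x) := by
  induction m generalizing i s with
  | zero =>
    obtain rfl : i = n := by omega
    have h1 : ¬ s.reg 1 < s.reg 0 := by rw [hs.r0, hs.r1]; exact lt_irrefl _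
    simp [exec, threeThresholds, hs.pc, step, h1, hs.r2, hs.log, val_selected_sequentialTesting,
      TestingAlgorithm.thresholds]
  | succ m ih =>
    have hin : i < n := by omega
    have h1 : s.reg 1 < s.reg 0 := by rw [hs.r0, hs.r1]; exact_mod_cast hin
    have hll : s.log.length = i := by rw [hs.log]; simp
    have hlen := (sequentialTesting 3 n τ hτ).length_history x (i := i) (by omega)
    have hhist : (sequentialTesting 3 n τ hτ).history x (i + 1) =
        (sequentialTesting 3 n τ hτ).history x i ++
          [open Classical in decide (s.reg 3 ≤ x ⟨i, hin⟩)] := by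
      rw [TestingAlgorithm.history, dif_pos hin, hs.r3]; rfl
    have hlog : s.log ++ [s.reg 3] = (List.range (i + 1)).map fun j =>
        (sequentialTesting 3 n τ hτ).threshold ((sequentialTesting 3 n τ hτ).history x j) := by
      rw [List.range_succ, List.map_append, hs.log, hs.r3]; rfl
    obtain ⟨hpc, hr0, hr1, hr2, hr3, hr4, hr5, hr9, hr10, hr11, -⟩ := hs
    -- An accepted box costs 11 steps, a positive test after three acceptances 7, a negative test 5,
    -- and the exit 2. The opaque `M` makes `simp` unroll exactly one round.
    obtain ⟨M, hM⟩ : ∃ M, M = 11 * m + 2 := ⟨_, rfl⟩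
    rw [show 11 * (m + 1) + 2 = M + 11 by omega]
    rw [← hM] at ih
    by_cases hx : s.reg 3 ≤ x ⟨i, hin⟩
    · by_cases hk : ((sequentialTesting 3 n τ hτ).history x i).count true < 3
      · have h9 : 0 < s.reg 9 := by
          rw [hr9, min_eq_right hk.le, sub_pos]; exact_mod_cast hk
        simp [exec, threeThresholds, hpc, step, h1, hll, hin, Config.write, hx, hr11, hr10, h9,
          Function.update]
        change exec (threeThresholds a b c) Q x _ _ = _
        apply ih (i + 1) (by omega)
        constructor <;> simp [hhist, hx, acceptedIndex_concat, hk, hlen, hr0, hr1, hr5, hr10,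
          hr11, hr4, hlog]
        · exact (hτ2 _ (by omega)).symm
        · rw [hr9, min_eq_right hk.le]; ring
      · have h9 : ¬ 0 < s.reg 9 := by
          rw [hr9, min_eq_left (by omega)]; norm_num
        apply exec_mono (T := M + 7) (by omega)
        simp [exec, threeThresholds, hpc, step, h1, hll, hin, Config.write, hx, hr11, hr10, h9,
          Function.update]
        change exec (threeThresholds a b c) Q x _ _ = _
        apply ih (i + 1) (by omega)
        constructor <;> simp [hhist, hx, acceptedIndex_concat, hk, hr0, hr1, hr5, hr10,
          hr11, hr4, hlog, hr2]
        · rw [hr3, hτ2 _ (by omega)]; exact (hτ2 _ (by omega)).symm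
        · rw [hτ2 _ (by omega)]; exact (hτ2 _ (by omega)).symm
        · have hk' : (3 : ℝ) ≤ ((sequentialTesting 3 n τ hτ).history x i).count true := by
            exact_mod_cast not_lt.1 hk
          rw [hr9, min_eq_left (by omega), min_eq_left (by linarith)]; norm_num
    · apply exec_mono (T := M + 5) (by omega)
      simp [exec, threeThresholds, hpc, step, h1, hll, hin, Config.write, hx, hr11, hr10,
        Function.update]
      change exec (threeThresholds a b c) Q x _ _ = _
      apply ih (i + 1) (by omega)
      constructor <;> simp [hhist, hx, acceptedIndex_concat, hr0, hr1, hr5, hr10,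
          hr11, hr4, hlog, hr2, hr9]
      exact hr3

theorem implements_threeThresholds (μ : Measure ℝ) {a b c : ℚ}
    (h0 : τ 0 = quantile μ (1 - a / n)) (h1 : τ 1 = quantile μ (1 - b / n))
    (h2 : ∀ j, 2 ≤ j → τ j = quantile μ (1 - c / n)) :
    (threeThresholds a b c).Implements μ (sequentialTesting 3 n τ hτ) (27 * n) := by
  intro x
  have hn : (n : ℝ) ≠ 0 := Nat.cast_ne_zero.2 (NeZero.ne n)
  have hn1 : 1 ≤ n := NeZero.one_le
  obtain ⟨M, hM⟩ : ∃ M, M = 11 * n + 2 := ⟨_, rfl⟩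
  -- 14 steps of preparation and 11 n + 2 for the loop are at most 27 n, as n ≥ 1.
  apply exec_mono (T := M + 14) (by omega)
  simp [exec, threeThresholds, Config.init, step, hn, Config.write, Function.update]
  change exec (threeThresholds a b c) _ x M _ = _
  rw [hM]
  apply exec_loop (hτ := hτ) (fun j hj => (h2 j hj).trans (h2 2 le_rfl).symm) n 0 (by omega)
  constructor <;> simp [TestingAlgorithm.history, acceptedIndex, scan, h0, h1, h2]

end

/-! ### Quantiles of atomless distributions -/

theorem quantile_nonneg (μ : Measure ℝ) (p : ℝ) : 0 ≤ quantile μ p :=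
  Real.sInf_nonneg fun _ hx => hx.1

section

variable {μ : Measure ℝ} [IsProbabilityMeasure μ]

theorem measure_singleton_eq_zero_of_continuous_cdf (hc : Continuous (cdf μ)) (x : ℝ) :
    μ {x} = 0 := by
  have h := (cdf μ).measure_singleton x
  rw [measure_cdf, (hc.continuousAt.continuousWithinAt).leftLim_eq] at h
  simpa using h

theorem real_Ici_eq_of_continuous_cdf (hc : Continuous (cdf μ)) (x : ℝ) :
    μ.real (Set.Ici x) = 1 - cdf μ x := by
  have : NullSingletonClass μ := ⟨measure_singleton_eq_zero_of_continuous_cdf hc⟩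
  rw [cdf_eq_real, ← probReal_compl_eq_one_sub measurableSet_Iic, Set.compl_Iic]
  exact measureReal_congr Ioi_ae_eq_Ici.symm

/-- The infimum is attained because the set is closed, which gives ≥. For ≤, approach a positive
quantile from the left, where the cdf stays below `p`; at quantile 0 the cdf vanishes, there being
no atom and no negative mass. -/
theorem cdf_quantile (h0 : μ (Set.Iio 0) = 0) (hc : Continuous (cdf μ)) {p : ℝ} (hp0 : 0 ≤ p)
    (hp1 : p < 1) : cdf μ (quantile μ p) = p := by
  set S : Set ℝ := {x : ℝ | 0 ≤ x ∧ p ≤ cdf μ x} with hS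
  have hbdd : BddBelow S := ⟨0, fun x hx => hx.1⟩
  have hne : S.Nonempty := by
    obtain ⟨x, hx1, hx2⟩ :=
      (((tendsto_cdf_atTop μ).eventually (lt_mem_nhds hp1)).and (eventually_ge_atTop 0)).exists
    exact ⟨x, hx2, hx1.le⟩
  have hclosed : IsClosed S :=
    (isClosed_le continuous_const continuous_id).inter (isClosed_le continuous_const hc)
  have hmem : quantile μ p ∈ S := hclosed.csInf_mem hne hbdd
  refine le_antisymm ?_ hmem.2
  rcases hmem.1.eq_or_lt with hq | hq
  · rw [← hq, cdf_eq_real, ← Set.Iio_insert]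
    have : μ (insert 0 (Set.Iio 0)) = 0 :=
      measure_union_null (measure_singleton_eq_zero_of_continuous_cdf hc 0) h0
    rw [measureReal_def, this]
    simpa using hp0
  · have hlt : ∀ᶠ x in 𝓝[<] (quantile μ p), cdf μ x ≤ p := by
      filter_upwards [Ioo_mem_nhdsLT hq] with x hx
      by_contra! h
      exact absurd (csInf_le hbdd ⟨hx.1.le, h.le⟩) (not_le.2 hx.2)
    exact le_of_tendsto (hc.continuousAt.continuousWithinAt (s := Set.Iio _)) hlt

theorem real_Ici_quantile (h0 : μ (Set.Iio 0) = 0) (hc : Continuous (cdf μ)) {q : ℝ} (hq0 : 0 < q)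
    (hq1 : q ≤ 1) : μ.real (Set.Ici (quantile μ (1 - q))) = q := by
  rw [real_Ici_eq_of_continuous_cdf hc, cdf_quantile h0 hc (by linarith) (by linarith)]
  ring

end

/-! ### The law of the process -/

section

variable {Ω : Type u} {k n : ℕ} {τ : ℕ → ℝ} {Y : ℕ → Ω → ℝ}

/-- The fine σ-algebra matters: the state before test `i` depends only on earlier boxes and so is
independent of `Y i`. -/
theorem measurable_process (i : ℕ) :
    Measurable[⨆ j ∈ Set.Iio i, MeasurableSpace.comap (Y j) inferInstance]
      fun ω => process k τ (fun j => Y j ω) i := by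
  induction i with
  | zero => exact @measurable_const _ _ _ (_) _
  | succ i ih =>
    set m := ⨆ j ∈ Set.Iio (i + 1), MeasurableSpace.comap (Y j) inferInstance with hm
    have hprev : Measurable[m] fun ω => process k τ (fun j => Y j ω) i :=
      ih.mono (biSup_mono fun j hj => lt_trans hj (Nat.lt_succ_self i)) le_rfl
    have hY : Measurable[m] (Y i) := by
      rw [measurable_iff_comap_le]
      exact le_biSup (fun j => MeasurableSpace.comap (Y j) inferInstance)
        (show i ∈ Set.Iio (i + 1) from Nat.lt_succ_self i)
    have h1 : Measurable[m] fun ω => (process k τ (fun j => Y j ω) i).1 :=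
      measurable_fst.comp hprev
    simp only [process]
    refine Measurable.ite ?_ ?_ hprev
    · refine MeasurableSet.inter ?_ ?_
      · exact h1 (measurableSet_Iio (a := k))
      · exact measurableSet_le ((measurable_of_countable τ).comp h1) hY
    · exact ((measurable_of_countable (· + 1)).comp h1).prodMk hY

/-- The event that `j` boxes have been accepted after `i` tests and the value in the last one
belongs to `U`. -/
def processEvent (k : ℕ) (τ : ℕ → ℝ) (Y : ℕ → Ω → ℝ) (i j : ℕ) (U : Set ℝ) : Set Ω :=
  {ω | (process k τ (fun m => Y m ω) i).1 = j ∧ (process k τ (fun m => Y m ω) i).2 ∈ U}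

theorem measurableSet_processEvent' (i j : ℕ) {U : Set ℝ} (hU : MeasurableSet U) :
    MeasurableSet[⨆ j ∈ Set.Iio i, MeasurableSpace.comap (Y j) inferInstance]
      (processEvent k τ Y i j U) :=
  measurable_process i ((measurableSet_singleton j).prod hU)

variable [MeasurableSpace Ω] {ν : Measure Ω} {μ : Measure ℝ}

theorem measurableSet_processEvent (hY : ∀ i, Measurable (Y i)) (i j : ℕ) {U : Set ℝ}
    (hU : MeasurableSet U) : MeasurableSet (processEvent k τ Y i j U) :=
  (iSup₂_le fun j _ => (hY j).comap_le) _ (measurableSet_processEvent' i j hU)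

/-- The value of each of the first `n` members of `Y` is independent of the previous ones and has
law `μ`. -/
structure IsIIDUpTo (Y : ℕ → Ω → ℝ) (ν : Measure Ω) (μ : Measure ℝ) (n : ℕ) : Prop where
  measurable : ∀ i, Measurable (Y i)
  indep : ∀ i < n, Indep (⨆ j ∈ Set.Iio i, MeasurableSpace.comap (Y j) inferInstance)
    (MeasurableSpace.comap (Y i) inferInstance) ν
  map_eq : ∀ i < n, ν.map (Y i) = μ

theorem IsIIDUpTo.real_processEvent_inter (h : IsIIDUpTo Y ν μ n) {i : ℕ} (hi : i < n) (j : ℕ)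
    {U V : Set ℝ} (hU : MeasurableSet U) (hV : MeasurableSet V) :
    ν.real (processEvent k τ Y i j U ∩ Y i ⁻¹' V) =
      ν.real (processEvent k τ Y i j U) * μ.real V := by
  rw [← h.map_eq i hi, map_measureReal_apply (h.measurable i) hV]
  simp only [measureReal_def]
  rw [(Indep_iff _ _ ν).1 (h.indep i hi) _ _ (measurableSet_processEvent' i j hU) ⟨V, hV, rfl⟩,
    ENNReal.toReal_mul]

theorem IsIIDUpTo.real_processEvent_zero (h : IsIIDUpTo Y ν μ n) [IsProbabilityMeasure μ]
    {i : ℕ} (hi : i < n) (hk : 0 < k) {U : Set ℝ} (hU : MeasurableSet U) :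
    ν.real (processEvent k τ Y (i + 1) 0 U) =
      ν.real (processEvent k τ Y i 0 U) * (1 - μ.real (Set.Ici (τ 0))) := by
  rw [← probReal_compl_eq_one_sub measurableSet_Ici,
    ← h.real_processEvent_inter hi 0 hU measurableSet_Ici.compl]
  congr 1
  ext ω
  simp only [processEvent, process, Set.mem_ofPred_eq, Set.mem_inter_iff, Set.mem_preimage,
    Set.mem_compl_iff, Set.mem_Ici]
  generalize process k τ (fun m => Y m ω) i = s
  rcases s with ⟨j, v⟩
  dsimp only
  split_ifs with hs
  · constructor
    · rintro ⟨h1, -⟩; simp at h1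
    · rintro ⟨⟨rfl, -⟩, h2⟩; exact absurd hs.2 h2
  · constructor
    · rintro ⟨rfl, h2⟩
      exact ⟨⟨rfl, h2⟩, fun h3 => hs ⟨hk, h3⟩⟩
    · exact fun h1 => h1.1

variable [IsProbabilityMeasure ν]

theorem IsIIDUpTo.real_processEvent_succ (h : IsIIDUpTo Y ν μ n) [IsProbabilityMeasure μ]
    {i j : ℕ} (hi : i < n) (hj : j + 1 < k) {U : Set ℝ} (hU : MeasurableSet U) :
    ν.real (processEvent k τ Y (i + 1) (j + 1) U) =
      ν.real (processEvent k τ Y i (j + 1) U) * (1 - μ.real (Set.Ici (τ (j + 1)))) +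
      ν.real (processEvent k τ Y i j Set.univ) * μ.real (Set.Ici (τ j) ∩ U) := by
  rw [← probReal_compl_eq_one_sub measurableSet_Ici,
    ← h.real_processEvent_inter hi _ hU measurableSet_Ici.compl,
    ← h.real_processEvent_inter hi _ MeasurableSet.univ (measurableSet_Ici.inter hU),
    ← measureReal_union]
  · congr 1
    ext ω
    simp only [processEvent, process, Set.mem_ofPred_eq, Set.mem_inter_iff, Set.mem_preimage,
      Set.mem_compl_iff, Set.mem_Ici, Set.mem_union, Set.mem_univ, and_true]
    generalize process k τ (fun m => Y m ω) i = s
    rcases s with ⟨l, v⟩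
    dsimp only
    split_ifs with hs
    · constructor
      · rintro ⟨h1, h2⟩
        obtain rfl : l = j := by omega
        exact Or.inr ⟨rfl, hs.2, h2⟩
      · rintro (⟨⟨rfl, -⟩, h2⟩ | ⟨rfl, -, h2⟩)
        · exact absurd hs.2 h2
        · exact ⟨rfl, h2⟩
    · constructor
      · rintro ⟨rfl, h2⟩
        exact Or.inl ⟨⟨rfl, h2⟩, fun h3 => hs ⟨hj, h3⟩⟩
      · rintro (h1 | ⟨rfl, h2, -⟩)
        · exact h1.1
        · exact absurd ⟨by omega, h2⟩ hs
  · rw [Set.disjoint_left]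
    rintro ω ⟨⟨h1, -⟩, -⟩ ⟨⟨h2, -⟩, -⟩
    omega
  · exact (measurableSet_processEvent h.measurable _ _ MeasurableSet.univ).inter
      (h.measurable i (measurableSet_Ici.inter hU))

theorem IsIIDUpTo.real_processEvent_last (h : IsIIDUpTo Y ν μ n) [IsProbabilityMeasure μ]
    {i j : ℕ} (hi : i < n) (hj : j + 1 = k) {U : Set ℝ} (hU : MeasurableSet U) :
    ν.real (processEvent k τ Y (i + 1) (j + 1) U) =
      ν.real (processEvent k τ Y i (j + 1) U) +
      ν.real (processEvent k τ Y i j Set.univ) * μ.real (Set.Ici (τ j) ∩ U) := by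
  rw [← h.real_processEvent_inter hi _ MeasurableSet.univ (measurableSet_Ici.inter hU),
    ← measureReal_union]
  · congr 1
    ext ω
    simp only [processEvent, process, Set.mem_ofPred_eq, Set.mem_inter_iff, Set.mem_preimage,
      Set.mem_Ici, Set.mem_union, Set.mem_univ, and_true]
    generalize process k τ (fun m => Y m ω) i = s
    rcases s with ⟨l, v⟩
    dsimp only
    split_ifs with hs
    · constructor
      · rintro ⟨h1, h2⟩
        obtain rfl : l = j := by omega
        exact Or.inr ⟨rfl, hs.2, h2⟩
      · rintro (⟨rfl, -⟩ | ⟨rfl, -, h2⟩)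
        · omega
        · exact ⟨rfl, h2⟩
    · constructor
      · exact Or.inl
      · rintro (h1 | ⟨rfl, h2, -⟩)
        · exact h1
        · exact absurd ⟨by omega, h2⟩ hs
  · rw [Set.disjoint_left]
    rintro ω ⟨h1, -⟩ ⟨⟨h2, -⟩, -⟩
    omega
  · exact (measurableSet_processEvent h.measurable _ _ MeasurableSet.univ).inter
      (h.measurable i (measurableSet_Ici.inter hU))

/-- Given the number of accepted boxes, the value in the last one is distributed as a value that
passes the last threshold. -/
theorem IsIIDUpTo.real_processEvent_mul (h : IsIIDUpTo Y ν μ n) [IsProbabilityMeasure μ]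
    {i j : ℕ} (hi : i ≤ n) (hj : j + 1 ≤ k) {U : Set ℝ} (hU : MeasurableSet U) :
    ν.real (processEvent k τ Y i (j + 1) U) * μ.real (Set.Ici (τ j)) =
      ν.real (processEvent k τ Y i (j + 1) Set.univ) * μ.real (Set.Ici (τ j) ∩ U) := by
  -- Both sides satisfy the same linear recurrence in `i`: a new acceptance contributes to either
  -- side the probability of `j` acceptances times both tail measures.
  induction i with
  | zero => simp [processEvent, process]
  | succ i ih =>
    have ih := ih (by omega)
    rcases hj.lt_or_eq with hj | hj
    · rw [h.real_processEvent_succ hi hj hU, h.real_processEvent_succ hi hj .univ, Set.inter_univ]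
      linear_combination (1 - μ.real (Set.Ici (τ (j + 1)))) * ih
    · rw [h.real_processEvent_last hi hj hU, h.real_processEvent_last hi hj .univ, Set.inter_univ]
      linear_combination ih

theorem process_fst_le (k : ℕ) (τ : ℕ → ℝ) (y : ℕ → ℝ) (i : ℕ) : (process k τ y i).1 ≤ k := by
  induction i with
  | zero => exact Nat.zero_le _
  | succ i ih =>
    rw [process]
    split_ifs with h
    · exact h.1
    · exact ih

theorem sum_real_processEvent (hY : ∀ i, Measurable (Y i)) (i : ℕ) {U : Set ℝ}
    (hU : MeasurableSet U) :
    ∑ j ∈ Finset.range (k + 1), ν.real (processEvent k τ Y i j U) =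
      ν.real {ω | (process k τ (fun m => Y m ω) i).2 ∈ U} := by
  rw [← measureReal_biUnion_finset]
  · congr 1
    ext ω
    have := process_fst_le k τ (fun m => Y m ω) i
    simp [processEvent]
    omega
  · intro a _ b _ hab
    rw [Function.onFun, Set.disjoint_left]
    rintro ω ⟨h1, -⟩ ⟨h2, -⟩
    exact hab (h1.symm.trans h2)
  · exact fun j _ => measurableSet_processEvent hY i j hU

end

/-! ### Numerical estimates -/

/-- Taylor polynomial with ten terms; 11 / 36288000 = 11 / (10! · 10) is the constant of the
remainder bound. Arguments beyond 1 are reached by taking powers. -/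
theorem abs_exp_neg_sub_le {x y δ : ℝ} (hx0 : 0 ≤ x) (hx1 : x ≤ 1)
    (h1 : |∑ m ∈ Finset.range 10, (-x) ^ m / (m.factorial : ℝ) - y| ≤ δ)
    (h2 : x ^ 10 * (11 / 36288000) ≤ δ) : |Real.exp (-x) - y| ≤ 2 * δ := by
  have h := Real.exp_bound (x := -x) (by rwa [abs_neg, abs_of_nonneg hx0]) (n := 10) (by norm_num)
  rw [abs_neg, abs_of_nonneg hx0] at h
  norm_num [Nat.factorial] at h h1 ⊢
  have := abs_sub_le (Real.exp (-x)) (∑ m ∈ Finset.range 10, (-x) ^ m / (m.factorial : ℝ)) y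
  linarith

theorem exp_neg_first_bounds :
    0.13066283 ≤ Real.exp (-2.035135) ∧ Real.exp (-2.035135) ≤ 0.13066285 := by
  have h : |Real.exp (-(0.50878375 : ℝ)) - 0.601226376| ≤ 2 * 2e-9 := by
    apply abs_exp_neg_sub_le (by norm_num) (by norm_num)
    · norm_num [Finset.sum_range_succ, Nat.factorial, abs_le]
    · norm_num
  rw [abs_le] at h
  have h4 : Real.exp (-2.035135) = Real.exp (-(0.50878375 : ℝ)) ^ 4 := by
    rw [← Real.exp_nat_mul]; norm_num
  rw [h4]
  constructor
  · calc (0.13066283 : ℝ) ≤ 0.60122637 ^ 4 := by norm_num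
      _ ≤ _ := pow_le_pow_left₀ (by norm_num) (by linarith) 4
  · calc _ ≤ (0.60122638 : ℝ) ^ 4 := pow_le_pow_left₀ (Real.exp_pos _).le (by linarith) 4
      _ ≤ _ := by norm_num

theorem exp_neg_second_bounds :
    0.60272152 ≤ Real.exp (-0.5063) ∧ Real.exp (-0.5063) ≤ 0.60272154 := by
  have h : |Real.exp (-(0.5063 : ℝ)) - 0.602721528| ≤ 2 * 2e-9 := by
    apply abs_exp_neg_sub_le (by norm_num) (by norm_num)
    · norm_num [Finset.sum_range_succ, Nat.factorial, abs_le]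
    · norm_num
  rw [abs_le] at h
  constructor <;> linarith

theorem exp_neg_third_bounds :
    0.94458462 ≤ Real.exp (-0.05701) ∧ Real.exp (-0.05701) ≤ 0.94458463 := by
  have h : |Real.exp (-(0.05701 : ℝ)) - 0.9445846235| ≤ 2 * 1e-9 := by
    apply abs_exp_neg_sub_le (by norm_num) (by norm_num)
    · norm_num [Finset.sum_range_succ, Nat.factorial, abs_le]
    · norm_num
  rw [abs_le] at h
  constructor <;> linarith

/-- A lower bound for the probability that the box in the limit of quantile testing has a value
among the top `l / n` by the probability that the best box has. -/
theorem one_sub_exp_neg_le_sum_min {l : ℝ} (hl : 0 ≤ l) :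
    0.8692 * (1 - Real.exp (-l)) ≤ 0.628388 * min 1 (l / 2.035135) +
      0.235507 * min 1 (l / 0.5063) + 0.005439 * min 1 (l / 0.05701) := by
  -- The right side of the claim is piecewise linear in `l`, so on each piece a tangent of exp(-l)
  -- suffices. The points 0.1161 and 1.035 are where 0.8692 exp(-a) nearly equals the slope of the
  -- second and third piece; the first uses a = 0, the last only positivity.
  have tangent : ∀ a E : ℝ, 0 ≤ E → E ≤ Real.exp (-a) → E * (1 + a - l) ≤ Real.exp (-l) := by
    intro a E hE0 hE
    calc E * (1 + a - l) ≤ E * Real.exp (a - l) := by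
          have := Real.add_one_le_exp (a - l)
          exact mul_le_mul_of_nonneg_left (by linarith) hE0
      _ ≤ Real.exp (-a) * Real.exp (a - l) := by gcongr
      _ = Real.exp (-l) := by rw [← Real.exp_add]; congr 1; ring
  have e1 : (0.890386 : ℝ) ≤ Real.exp (-0.1161) := by
    have h : |Real.exp (-(0.1161 : ℝ)) - 0.89038618| ≤ 2 * 1e-8 := by
      apply abs_exp_neg_sub_le (by norm_num) (by norm_num)
      · norm_num [Finset.sum_range_succ, Nat.factorial, abs_le]
      · norm_num
    rw [abs_le] at h
    linarith
  have e2 : (0.355226 : ℝ) ≤ Real.exp (-1.035) := by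
    have h : |Real.exp (-(0.5175 : ℝ)) - 0.596008708| ≤ 2 * 1e-8 := by
      apply abs_exp_neg_sub_le (by norm_num) (by norm_num)
      · norm_num [Finset.sum_range_succ, Nat.factorial, abs_le]
      · norm_num
    rw [abs_le] at h
    have h2 : Real.exp (-1.035) = Real.exp (-(0.5175 : ℝ)) ^ 2 := by
      rw [← Real.exp_nat_mul]; norm_num
    rw [h2]
    calc (0.355226 : ℝ) ≤ 0.59600868 ^ 2 := by norm_num
      _ ≤ _ := pow_le_pow_left₀ (by norm_num) (by linarith) 2
  have t0 := tangent 0 1 zero_le_one (by simp)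
  have t1 := tangent _ _ (by norm_num) e1
  have t2 := tangent _ _ (by norm_num) e2
  have t3 := Real.exp_pos (-l)
  have small : ∀ b : ℝ, 0 < b → l ≤ b → min 1 (l / b) = l / b := fun b hb h =>
    min_eq_right ((div_le_one hb).2 h)
  have large : ∀ b : ℝ, 0 < b → b ≤ l → min 1 (l / b) = 1 := fun b hb h =>
    min_eq_left ((one_le_div hb).2 h)
  have d1 : l / 2.035135 = l * (200000 / 407027) := by norm_num [div_eq_mul_inv]
  have d2 : l / 0.5063 = l * (10000 / 5063) := by norm_num [div_eq_mul_inv]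
  have d3 : l / 0.05701 = l * (100000 / 5701) := by norm_num [div_eq_mul_inv]
  rcases le_total l 0.05701 with h3 | h3
  · rw [small _ (by norm_num) h3, small _ (by norm_num) (by linarith),
      small _ (by norm_num) (by linarith), d1, d2, d3]
    linarith
  rw [large 0.05701 (by norm_num) h3]
  rcases le_total l 0.5063 with h2 | h2
  · rw [small _ (by norm_num) h2, small _ (by norm_num) (by linarith), d1, d2]
    linarith
  rw [large 0.5063 (by norm_num) h2]
  rcases le_total l 2.035135 with h1 | h1
  · rw [small _ (by norm_num) h1, d1]
    linarith
  rw [large _ (by norm_num) h1]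
  linarith

/-- Comparison of the maximum of `n` uniform variables with its Poisson limit. -/
theorem one_sub_pow_le_mul_one_sub_exp {q : ℝ} (hq0 : 0 ≤ q) (hq1 : q ≤ 1) {n : ℕ} (hn : 1 ≤ n) :
    1 - (1 - q) ^ n ≤ (1 + 2 / n) * (1 - Real.exp (-(n * q))) := by
  have hn0 : (0 : ℝ) < n := by exact_mod_cast hn
  set l : ℝ := n * q with hl
  have hl0 : 0 ≤ l := by positivity
  have h1 : Real.exp (-l) * (1 - l ^ 2 / n) ≤ (1 - q) ^ n := by
    have hb : 1 - l ^ 2 / n ≤ (1 - q ^ 2) ^ n := by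
      have := one_add_mul_le_pow (a := -q ^ 2) (by nlinarith) n
      rw [← sub_eq_add_neg] at this
      refine le_trans (le_of_eq ?_) this
      rw [hl]; field_simp; ring
    have he : (1 - q ^ 2) ^ n ≤ (1 - q) ^ n * Real.exp l := by
      rw [hl, Real.exp_nat_mul, ← mul_pow]
      apply pow_le_pow_left₀ (by nlinarith)
      have := Real.add_one_le_exp q
      nlinarith
    calc Real.exp (-l) * (1 - l ^ 2 / n) ≤ Real.exp (-l) * ((1 - q) ^ n * Real.exp l) :=
          mul_le_mul_of_nonneg_left (hb.trans he) (Real.exp_pos _).le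
      _ = (1 - q) ^ n * (Real.exp (-l) * Real.exp l) := by ring
      _ = (1 - q) ^ n := by rw [← Real.exp_add]; simp
  -- Turns the additive error into a relative one, as is needed for small `l`.
  have h2 : Real.exp (-l) * l ^ 2 ≤ 2 * (1 - Real.exp (-l)) := by
    have hq := Real.quadratic_le_exp_of_nonneg hl0
    have : Real.exp (-l) * Real.exp l = 1 := by rw [← Real.exp_add]; simp
    nlinarith [Real.exp_pos (-l), mul_le_mul_of_nonneg_left hq (Real.exp_pos (-l)).le,
      mul_nonneg (Real.exp_pos (-l)).le hl0]
  have h3 : Real.exp (-l) * l ^ 2 / n ≤ 2 * (1 - Real.exp (-l)) / n := by gcongr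
  have h4 : Real.exp (-l) * (1 - l ^ 2 / n) = Real.exp (-l) - Real.exp (-l) * l ^ 2 / n := by ring
  have h5 : (1 + 2 / n) * (1 - Real.exp (-l)) =
    (1 - Real.exp (-l)) + 2 * (1 - Real.exp (-l)) / n := by ring
  linarith

/-- The probability that exactly one box is accepted, in terms of the probabilities `X` and `Y`
that all tests with the first and with the second threshold are negative. -/
def probOne (a b X Y : ℝ) : ℝ :=
  a * (Y - X) / (a - b)

/-- The probability that exactly two boxes are accepted, in terms of the probabilities `X`, `Y`,
`Z` that all tests with the first, second and third threshold are negative. -/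
def probTwo (a b c X Y Z : ℝ) : ℝ :=
  a * b * ((b - c) * X - (a - c) * Y + (a - b) * Z) / ((a - b) * (a - c) * (b - c))

/-- Both sides of `h` scale with m⁻³, so the success probabilities α/n may be replaced by α. -/
theorem eq_probTwo {a b c m X Y Z w : ℝ} (hab : a ≠ b) (hac : a ≠ c) (hbc : b ≠ c) (hm : m ≠ 0)
    (h : (a / m - b / m) * (a / m - c / m) * (b / m - c / m) * w =
      a / m * (b / m) * ((b / m - c / m) * X - (a / m - c / m) * Y + (a / m - b / m) * Z)) :
    w = probTwo a b c X Y Z := by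
  have h1 := sub_ne_zero.2 hab
  have h2 := sub_ne_zero.2 hac
  have h3 := sub_ne_zero.2 hbc
  rw [probTwo, eq_div_iff (by positivity)]
  have h4 : m ^ 3 * ((a / m - b / m) * (a / m - c / m) * (b / m - c / m) * w) =
      w * ((a - b) * (a - c) * (b - c)) := by field_simp
  have h5 : m ^ 3 * (a / m * (b / m) * ((b / m - c / m) * X - (a / m - c / m) * Y +
      (a / m - b / m) * Z)) = a * b * ((b - c) * X - (a - c) * Y + (a - b) * Z) := by field_simp
  rw [← h4, ← h5, h]

theorem limit_probabilities_bounds :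
    0.628388 < probOne 2.035135 0.5063 (Real.exp (-2.035135)) (Real.exp (-0.5063)) ∧
    0.235507 < probTwo 2.035135 0.5063 0.05701 (Real.exp (-2.035135)) (Real.exp (-0.5063))
      (Real.exp (-0.05701)) ∧
    0.005439 < 1 - Real.exp (-2.035135) -
      probOne 2.035135 0.5063 (Real.exp (-2.035135)) (Real.exp (-0.5063)) -
      probTwo 2.035135 0.5063 0.05701 (Real.exp (-2.035135)) (Real.exp (-0.5063))
        (Real.exp (-0.05701)) := by
  have h1 := exp_neg_first_bounds
  have h2 := exp_neg_second_bounds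
  have h3 := exp_neg_third_bounds
  generalize Real.exp (-2.035135) = X at *
  generalize Real.exp (-0.5063) = Y at *
  generalize Real.exp (-0.05701) = Z at *
  unfold probOne probTwo
  norm_num at *
  refine ⟨?_, ?_, ?_⟩ <;> linarith

theorem eventually_probabilities_bounds :
    ∀ᶠ n : ℕ in atTop,
      0.628388 < probOne 2.035135 0.5063 ((1 - 2.035135 / n) ^ n) ((1 - 0.5063 / n) ^ n) ∧
      0.235507 < probTwo 2.035135 0.5063 0.05701 ((1 - 2.035135 / n) ^ n) ((1 - 0.5063 / n) ^ n)
        ((1 - 0.05701 / n) ^ n) ∧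
      0.005439 < 1 - (1 - 2.035135 / (n : ℝ)) ^ n -
        probOne 2.035135 0.5063 ((1 - 2.035135 / n) ^ n) ((1 - 0.5063 / n) ^ n) -
        probTwo 2.035135 0.5063 0.05701 ((1 - 2.035135 / n) ^ n) ((1 - 0.5063 / n) ^ n)
          ((1 - 0.05701 / n) ^ n) := by
  have lim : ∀ a : ℝ, Tendsto (fun n : ℕ => (1 - a / n) ^ n) atTop (𝓝 (Real.exp (-a))) := by
    intro a
    refine (Real.tendsto_one_add_div_pow_exp (-a)).congr fun n => ?_
    rw [neg_div, ← sub_eq_add_neg]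
  have one : Tendsto (fun n : ℕ => probOne 2.035135 0.5063 ((1 - 2.035135 / n) ^ n)
      ((1 - 0.5063 / n) ^ n)) atTop (𝓝 (probOne 2.035135 0.5063 (Real.exp (-2.035135))
      (Real.exp (-0.5063)))) :=
    (((lim 0.5063).sub (lim 2.035135)).const_mul _).div_const _
  have two : Tendsto (fun n : ℕ => probTwo 2.035135 0.5063 0.05701 ((1 - 2.035135 / n) ^ n)
      ((1 - 0.5063 / n) ^ n) ((1 - 0.05701 / n) ^ n)) atTop
      (𝓝 (probTwo 2.035135 0.5063 0.05701 (Real.exp (-2.035135)) (Real.exp (-0.5063))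
        (Real.exp (-0.05701)))) :=
    (((((lim 2.035135).const_mul _).sub ((lim 0.5063).const_mul _)).add
      ((lim 0.05701).const_mul _)).const_mul _).div_const _
  obtain ⟨h1, h2, h3⟩ := limit_probabilities_bounds
  exact (one.eventually_const_lt h1).and ((two.eventually_const_lt h2).and
    ((((lim 2.035135).const_sub 1).sub one).sub two |>.eventually_const_lt h3))

/-! ### Comparison of the reward with the maximum -/

section

variable {Ω : Type u} [MeasurableSpace Ω] {ν : Measure Ω} [IsProbabilityMeasure ν] {n : ℕ}
  {τ : ℕ → ℝ} {Y : ℕ → Ω → ℝ} {μ : Measure ℝ} [IsProbabilityMeasure μ]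

theorem IsIIDUpTo.real_processEvent_zero_univ (h : IsIIDUpTo Y ν μ n) {i : ℕ} (hi : i ≤ n) :
    ν.real (processEvent 3 τ Y i 0 Set.univ) = (1 - μ.real (Set.Ici (τ 0))) ^ i := by
  induction i with
  | zero => simp [processEvent, process]
  | succ i ih =>
    rw [h.real_processEvent_zero hi (by norm_num) .univ, ih (by omega), pow_succ]

theorem IsIIDUpTo.real_processEvent_one_univ (h : IsIIDUpTo Y ν μ n) {i : ℕ} (hi : i ≤ n) :
    (μ.real (Set.Ici (τ 0)) - μ.real (Set.Ici (τ 1))) *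
      ν.real (processEvent 3 τ Y i 1 Set.univ) = μ.real (Set.Ici (τ 0)) *
        ((1 - μ.real (Set.Ici (τ 1))) ^ i - (1 - μ.real (Set.Ici (τ 0))) ^ i) := by
  induction i with
  | zero => simp [processEvent, process]
  | succ i ih =>
    rw [h.real_processEvent_succ hi (by norm_num) .univ, Set.inter_univ,
      h.real_processEvent_zero_univ (by omega)]
    linear_combination (1 - μ.real (Set.Ici (τ 1))) * ih (by omega)

/-- Solution of the recurrence with decay 1 - c, driven by the probability of one acceptance;
clearing denominators keeps the induction polynomial. -/
theorem IsIIDUpTo.real_processEvent_two_univ (h : IsIIDUpTo Y ν μ n) {i : ℕ} (hi : i ≤ n) {a b c : ℝ}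
    (ha : μ.real (Set.Ici (τ 0)) = a) (hb : μ.real (Set.Ici (τ 1)) = b)
    (hc : μ.real (Set.Ici (τ 2)) = c) :
    (a - b) * (a - c) * (b - c) * ν.real (processEvent 3 τ Y i 2 Set.univ) =
      a * b * ((b - c) * (1 - a) ^ i - (a - c) * (1 - b) ^ i + (a - b) * (1 - c) ^ i) := by
  induction i with
  | zero => simp [processEvent, process]
  | succ i ih =>
    have h1 := h.real_processEvent_one_univ (τ := τ) (i := i) (by omega)
    rw [h.real_processEvent_succ hi (by norm_num) .univ, Set.inter_univ]
    simp only [Nat.reduceAdd, ha, hb, hc] at h1 ⊢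
    linear_combination (1 - c) * ih (by omega) + b * (a - c) * (b - c) * h1

theorem sum_div_mul_min_le_real_process (h : IsIIDUpTo Y ν μ n) {a : ℕ → ℝ}
    (ha : ∀ j < 3, 0 < a j) (hn : 0 < n) (hτ : ∀ j < 3, μ.real (Set.Ici (τ j)) = a j / n) (t : ℝ) :
    ∑ j ∈ Finset.range 3, ν.real (processEvent 3 τ Y n (j + 1) Set.univ) *
        min 1 (n * μ.real (Set.Ici t) / a j) ≤
      ν.real {ω | 0 < (process 3 τ (fun m => Y m ω) n).1 ∧
        t ≤ (process 3 τ (fun m => Y m ω) n).2} := by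
  have hn0 : (0 : ℝ) < n := by exact_mod_cast hn
  calc _ = ∑ j ∈ Finset.range 3, ν.real (processEvent 3 τ Y n (j + 1) (Set.Ici t)) := by
        refine Finset.sum_congr rfl fun j hj => ?_
        have hj := Finset.mem_range.1 hj
        have h1 := h.real_processEvent_mul (τ := τ) (k := 3) le_rfl hj (measurableSet_Ici (a := t))
        have h2 : μ.real (Set.Ici (τ j) ∩ Set.Ici t) =
            min (a j / n) (μ.real (Set.Ici t)) := by
          rw [Set.Ici_inter_Ici, ← hτ j hj]
          rcases le_total (τ j) t with h | h
          · rw [sup_eq_right.2 h, min_eq_right]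
            exact measureReal_mono (Set.Ici_subset_Ici.2 h)
          · rw [sup_eq_left.2 h, min_eq_left]
            exact measureReal_mono (Set.Ici_subset_Ici.2 h)
        have h3 : min (a j / n) (μ.real (Set.Ici t)) =
            a j / n * min 1 (n * μ.real (Set.Ici t) / a j) := by
          have := ha j hj
          rw [mul_min_of_nonneg _ _ (by positivity), mul_one]
          congr 1
          field_simp
        have h4 : a j / n ≠ 0 := (div_pos (ha j hj) hn0).ne'
        rw [h2, hτ j hj, h3] at h1
        apply mul_right_cancel₀ h4
        linear_combination -h1
    _ ≤ _ := by
      rw [← measureReal_biUnion_finset]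
      · refine measureReal_mono ?_ (measure_ne_top _ _)
        intro ω hω
        simp only [Set.mem_iUnion, processEvent] at hω
        obtain ⟨j, -, h1, h2⟩ := hω
        exact ⟨by omega, h2⟩
      · intro a _ b _ hab
        rw [Function.onFun, Set.disjoint_left]
        rintro ω ⟨h1, -⟩ ⟨h2, -⟩
        exact hab (by omega)
      · exact fun j _ => measurableSet_processEvent h.measurable n (j + 1) measurableSet_Ici

/-- The property of `n` that the reward of quantile testing dominates, up to the factor `0.869`, the
maximum of `n` boxes. -/
def IsLarge (n : ℕ) : Prop :=
  3 ≤ n ∧ 0.869 * (1 + 2 / (n : ℝ)) ≤ 0.8692 ∧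
      0.628388 < probOne 2.035135 0.5063 ((1 - 2.035135 / n) ^ n) ((1 - 0.5063 / n) ^ n) ∧
      0.235507 < probTwo 2.035135 0.5063 0.05701 ((1 - 2.035135 / n) ^ n) ((1 - 0.5063 / n) ^ n)
        ((1 - 0.05701 / n) ^ n) ∧
      0.005439 < 1 - (1 - 2.035135 / (n : ℝ)) ^ n -
        probOne 2.035135 0.5063 ((1 - 2.035135 / n) ^ n) ((1 - 0.5063 / n) ^ n) -
        probTwo 2.035135 0.5063 0.05701 ((1 - 2.035135 / n) ^ n) ((1 - 0.5063 / n) ^ n)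
          ((1 - 0.05701 / n) ^ n)

theorem eventually_isLarge : ∀ᶠ n : ℕ in atTop, IsLarge n := by
  have h : Tendsto (fun n : ℕ => 0.869 * (1 + 2 / (n : ℝ))) atTop (𝓝 (0.869 * (1 + 0))) :=
    ((tendsto_const_div_atTop_nhds_zero_nat 2).const_add 1).const_mul _
  filter_upwards [eventually_ge_atTop 3, h.eventually_le_const (u := (0.8692 : ℝ)) (by norm_num),
    eventually_probabilities_bounds] with n h1 h2 h3
  exact ⟨h1, h2, h3⟩

theorem IsIIDUpTo.mul_one_sub_pow_le (h : IsIIDUpTo Y ν μ n) (hn : IsLarge n)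
    (h0 : μ.real (Set.Ici (τ 0)) = 2.035135 / n) (h1 : μ.real (Set.Ici (τ 1)) = 0.5063 / n)
    (h2 : μ.real (Set.Ici (τ 2)) = 0.05701 / n) (t : ℝ) :
    0.869 * (1 - (1 - μ.real (Set.Ici t)) ^ n) ≤
      ν.real {ω | 0 < (process 3 τ (fun m => Y m ω) n).1 ∧
        t ≤ (process 3 τ (fun m => Y m ω) n).2} := by
  obtain ⟨hn3, hn1, l1, l2, l3⟩ := hn
  have hn0 : (0 : ℝ) < n := by
    have : 0 < n := by omega
    exact_mod_cast this
  have w0 := h.real_processEvent_zero_univ (τ := τ) le_rfl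
  have w1 := h.real_processEvent_one_univ (τ := τ) le_rfl
  have w2 := h.real_processEvent_two_univ le_rfl h0 h1 h2
  -- Three acceptances get the remaining mass, so no third recurrence is solved.
  have w3 := sum_real_processEvent (k := 3) (τ := τ) (ν := ν) h.measurable n MeasurableSet.univ
  simp only [Finset.sum_range_succ, Finset.sum_range_zero, zero_add, Set.mem_univ,
    Set.ofPred_true, probReal_univ] at w3
  rw [h0] at w0
  rw [h0, h1] at w1
  have w1' : ν.real (processEvent 3 τ Y n 1 Set.univ) =
      probOne 2.035135 0.5063 ((1 - 2.035135 / n) ^ n) ((1 - 0.5063 / n) ^ n) := by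
    rw [probOne, eq_div_iff (by norm_num)]
    field_simp at w1 ⊢
    linear_combination w1
  have w2' : ν.real (processEvent 3 τ Y n 2 Set.univ) =
      probTwo 2.035135 0.5063 0.05701 ((1 - 2.035135 / n) ^ n) ((1 - 0.5063 / n) ^ n)
        ((1 - 0.05701 / n) ^ n) :=
    eq_probTwo (by norm_num) (by norm_num) (by norm_num) hn0.ne' w2
  rw [← w1'] at l1 l3
  rw [← w2'] at l2 l3
  rw [← w0] at l3
  have hq0 : 0 ≤ μ.real (Set.Ici t) := measureReal_nonneg
  have hq1 : μ.real (Set.Ici t) ≤ 1 := measureReal_le_one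
  set q := μ.real (Set.Ici t) with hq
  have key := sum_div_mul_min_le_real_process (τ := τ) h
    (a := fun j => if j = 0 then 2.035135 else if j = 1 then 0.5063 else 0.05701)
    (by intro j _; split_ifs <;> norm_num) (by omega)
    (by intro j hj; interval_cases j <;> simp [h0, h1, h2]) t
  simp only [Finset.sum_range_succ, Finset.sum_range_zero, zero_add, Nat.reduceAdd, if_true,
    one_ne_zero, if_false, OfNat.ofNat_ne_zero, OfNat.ofNat_ne_one, ← hq] at key
  have hnq : 0 ≤ n * q := by positivity
  have hm : ∀ b : ℝ, 0 < b → 0 ≤ min 1 (n * q / b) := fun b hb => le_min zero_le_one (by positivity)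
  calc 0.869 * (1 - (1 - q) ^ n)
      ≤ 0.869 * ((1 + 2 / n) * (1 - Real.exp (-(n * q)))) := by
        gcongr
        exact one_sub_pow_le_mul_one_sub_exp hq0 hq1 (by omega)
    _ = 0.869 * (1 + 2 / n) * (1 - Real.exp (-(n * q))) := by ring
    _ ≤ 0.8692 * (1 - Real.exp (-(n * q))) := by
        apply mul_le_mul_of_nonneg_right hn1
        rw [sub_nonneg, Real.exp_le_one_iff]
        linarith
    _ ≤ _ := one_sub_exp_neg_le_sum_min hnq
    _ ≤ _ := by
        refine le_trans ?_ key
        have := hm 2.035135 (by norm_num)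
        have := hm 0.5063 (by norm_num)
        have := hm 0.05701 (by norm_num)
        gcongr
        linarith

end

/-! ### Measurability, integrability and integration of tail bounds -/

section

variable {Ω : Type u} {n : ℕ} {X : Fin n → Ω → ℝ}

/-- The extension of finitely many random variables to a sequence. -/
def extendByZero (X : Fin n → Ω → ℝ) (i : ℕ) : Ω → ℝ :=
  if h : i < n then X ⟨i, h⟩ else 0

theorem extendByZero_of_lt {i : ℕ} (hi : i < n) : extendByZero X i = X ⟨i, hi⟩ := dif_pos hi

variable [MeasurableSpace Ω] {ν : Measure Ω} {μ : Measure ℝ}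

theorem isIIDUpTo_extendByZero (hX : ∀ i, Measurable (X i)) (hind : iIndepFun X ν)
    (hmap : ∀ i, ν.map (X i) = μ) : IsIIDUpTo (extendByZero X) ν μ n where
  measurable i := by
    by_cases hi : i < n
    · rw [extendByZero_of_lt hi]; exact hX _
    · rw [extendByZero, dif_neg hi]; exact measurable_zero
  indep i hi := by
    have h := indep_iSup_of_disjoint (fun j => (hX j).comap_le) hind.iIndep
      (S := {j : Fin n | (j : ℕ) < i}) (T := {⟨i, hi⟩}) (by simp)
    rw [extendByZero_of_lt hi]
    simp only [iSup_singleton] at h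
    refine indep_of_indep_of_le_left h (iSup₂_le fun j hj => ?_)
    have hji : j < i := hj
    rw [extendByZero_of_lt (hji.trans hi)]
    exact le_biSup (fun j => MeasurableSpace.comap (X j) inferInstance)
      (show (⟨j, hji.trans hi⟩ : Fin n) ∈ {j : Fin n | (j : ℕ) < i} from hji)
  map_eq i hi := by rw [extendByZero_of_lt hi, hmap]

theorem TestingAlgorithm.measurableSet_history_eq (A : TestingAlgorithm n)
    (hX : ∀ i, Measurable (X i)) (i : ℕ) (l : List Bool) :
    MeasurableSet {ω | A.history (fun j => X j ω) i = l} := by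
  induction i generalizing l with
  | zero => simp only [history]; exact MeasurableSet.const _
  | succ i ih =>
    by_cases hi : i < n
    · have : {ω | A.history (fun j => X j ω) (i + 1) = l} =
          ⋃ h : List Bool, {ω | A.history (fun j => X j ω) i = h} ∩
            ((X ⟨i, hi⟩ ⁻¹' Set.Ici (A.threshold h) ∩ {_ω | h ++ [true] = l}) ∪
              (X ⟨i, hi⟩ ⁻¹' Set.Iio (A.threshold h) ∩ {_ω | h ++ [false] = l})) := by
        ext ω
        simp only [history, dif_pos hi, Set.mem_ofPred_eq, Set.mem_iUnion, Set.mem_inter_iff,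
          Set.mem_union, Set.mem_preimage, Set.mem_Ici, Set.mem_Iio, exists_eq_left']
        by_cases h : A.threshold (A.history (fun j => X j ω) i) ≤ X ⟨i, hi⟩ ω
        · simp [h, not_lt.2 h]
        · simp [h, not_le.1 h]
      rw [this]
      exact MeasurableSet.iUnion fun h => (ih h).inter
        (((hX _ measurableSet_Ici).inter (MeasurableSet.const _)).union
          ((hX _ measurableSet_Iio).inter (MeasurableSet.const _)))
    · simpa only [history, dif_neg hi] using ih l

theorem TestingAlgorithm.measurable_selected (A : TestingAlgorithm n) (hX : ∀ i, Measurable (X i)) :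
    Measurable fun ω => A.selected fun j => X j ω := by
  refine measurable_to_countable' fun i => ?_
  have : (fun ω => A.selected fun j => X j ω) ⁻¹' {i} =
      ⋃ l : List Bool, {ω | A.history (fun j => X j ω) n = l} ∩ {_ω | A.choice l = i} := by
    ext ω
    simp [selected]
  rw [this]
  exact MeasurableSet.iUnion fun l =>
    (A.measurableSet_history_eq hX n l).inter (MeasurableSet.const _)

theorem TestingAlgorithm.measurable_reward (A : TestingAlgorithm n) (hX : ∀ i, Measurable (X i)) :
    Measurable fun ω => X (A.selected fun j => X j ω) ω := by
  have h : Measurable fun p : Fin n × Ω => X p.1 p.2 := measurable_from_prod_countable_right hX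
  exact h.comp ((A.measurable_selected hX).prodMk measurable_id)

theorem ae_nonneg_of_map_eq (hX : ∀ i, Measurable (X i)) (hmap : ∀ i, ν.map (X i) = μ)
    (h0 : μ (Set.Iio 0) = 0) : ∀ᵐ ω ∂ν, ∀ i, 0 ≤ X i ω := by
  rw [ae_all_iff]
  intro i
  rw [← hmap i, Measure.map_apply (hX i) measurableSet_Iio] at h0
  rw [ae_iff]
  simpa [Set.preimage, not_le] using h0

theorem integrable_of_forall_exists_eq (hX : ∀ i, Measurable (X i)) (hmap : ∀ i, ν.map (X i) = μ)
    (hint : Integrable (fun x : ℝ => x) μ) {f : Ω → ℝ} (hf : Measurable f)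
    (h : ∀ ω, ∃ i, f ω = X i ω) : Integrable f ν := by
  have hi : ∀ i, Integrable (X i) ν := fun i => by
    rw [← hmap i] at hint
    exact hint.comp_measurable (hX i)
  refine Integrable.mono' (integrable_finsetSum Finset.univ fun i _ => (hi i).abs)
    hf.aestronglyMeasurable (ae_of_all _ fun ω => ?_)
  obtain ⟨i, hi⟩ := h ω
  rw [hi, Real.norm_eq_abs]
  exact Finset.single_le_sum (f := fun i => |X i ω|) (fun _ _ => abs_nonneg _) (Finset.mem_univ i)

variable [IsProbabilityMeasure ν] [IsProbabilityMeasure μ]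

theorem real_le_iSup_le [NeZero n] (hX : ∀ i, Measurable (X i)) (hind : iIndepFun X ν)
    (hmap : ∀ i, ν.map (X i) = μ) (t : ℝ) :
    ν.real {ω | t ≤ ⨆ i, X i ω} ≤ 1 - (1 - μ.real (Set.Ici t)) ^ n := by
  have h1 : ν.real (⋂ i ∈ Finset.univ, X i ⁻¹' Set.Iio t) = (1 - μ.real (Set.Ici t)) ^ n := by
    rw [measureReal_def, hind.measure_inter_preimage_eq_mul _ (fun _ _ => measurableSet_Iio),
      ENNReal.toReal_prod, ← probReal_compl_eq_one_sub measurableSet_Ici, Set.compl_Ici]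
    have : ∀ i, (ν (X i ⁻¹' Set.Iio t)).toReal = μ.real (Set.Iio t) := fun i => by
      rw [← Measure.map_apply (hX i) measurableSet_Iio, hmap i, measureReal_def]
    simp [this]
  rw [← h1, ← probReal_compl_eq_one_sub
    (Finset.measurableSet_biInter _ fun i _ => hX i measurableSet_Iio)]
  refine measureReal_mono (fun ω hω h => ?_) (measure_ne_top _ _)
  obtain ⟨i, hi⟩ := exists_eq_ciSup_of_finite (f := fun i => X i ω)
  have h2 : X i ω < t := by simpa using Set.mem_iInter₂.1 h i (Finset.mem_univ i)
  exact absurd hω (not_le.2 (hi ▸ h2))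

/-- Layer-cake formula on both sides. -/
theorem mul_integral_le_of_forall_real {f g : Ω → ℝ} {c : ℝ} (hc : 0 ≤ c) (hf0 : 0 ≤ᵐ[ν] f)
    (hg0 : 0 ≤ᵐ[ν] g) (hf : Integrable f ν) (hg : Integrable g ν)
    (h : ∀ t, c * ν.real {ω | t ≤ f ω} ≤ ν.real {ω | t ≤ g ω}) :
    c * ∫ ω, f ω ∂ν ≤ ∫ ω, g ω ∂ν := by
  rw [← ENNReal.ofReal_le_ofReal_iff (integral_nonneg_of_ae hg0), ENNReal.ofReal_mul hc,
    ofReal_integral_eq_lintegral_ofReal hf hf0, ofReal_integral_eq_lintegral_ofReal hg hg0,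
    lintegral_eq_lintegral_meas_le ν hf0 hf.aemeasurable,
    lintegral_eq_lintegral_meas_le ν hg0 hg.aemeasurable,
    ← lintegral_const_mul' _ _ ENNReal.ofReal_ne_top]
  refine lintegral_mono fun t => ?_
  rw [← ofReal_measureReal, ← ofReal_measureReal, ← ENNReal.ofReal_mul hc]
  exact ENNReal.ofReal_le_ofReal (h t)

end

/-- The thresholds of the algorithm; the last one is kept after three positive tests. -/
def quantileThreshold (μ : Measure ℝ) (n : ℕ) : ℕ → ℝ
  | 0 => quantile μ (1 - 2.035135 / n)
  | 1 => quantile μ (1 - 0.5063 / n)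
  | _ + 2 => quantile μ (1 - 0.05701 / n)

theorem quantileThreshold_nonneg (μ : Measure ℝ) (n j : ℕ) : 0 ≤ quantileThreshold μ n j := by
  unfold quantileThreshold
  split <;> exact quantile_nonneg _ _

open Classical in
/-- The loss of the competitive ratio for small numbers of boxes. -/
def smallLoss (n : ℕ) : ℝ :=
  if IsLarge n then 0 else 0.869

theorem tendsto_smallLoss : Tendsto smallLoss atTop (𝓝 0) := by
  refine tendsto_const_nhds.congr' ?_
  filter_upwards [eventually_isLarge] with n hn
  rw [smallLoss, if_pos hn]

theorem isCompetitive_quantileThreshold {n : ℕ} [NeZero n] {μ : Measure ℝ} [IsProbabilityMeasure μ]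
    (h0 : μ (Set.Iio 0) = 0) (hint : Integrable (fun x : ℝ => x) μ) (hc : Continuous (cdf μ)) :
    (sequentialTesting 3 n (quantileThreshold μ n)
      (quantileThreshold_nonneg μ n)).IsCompetitive μ (0.869 - smallLoss n) := by
  intro Ω _ ν _ X hX hind hmap
  set A := sequentialTesting 3 n (quantileThreshold μ n) (quantileThreshold_nonneg μ n) with hA
  have hpos := ae_nonneg_of_map_eq hX hmap h0
  have hR : Integrable (fun ω => X (A.selected fun i => X i ω) ω) ν :=
    integrable_of_forall_exists_eq hX hmap hint (A.measurable_reward hX) fun ω => ⟨_, rfl⟩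
  have hR0 : 0 ≤ᵐ[ν] fun ω => X (A.selected fun i => X i ω) ω := hpos.mono fun ω h => h _
  refine ⟨hR, ?_⟩
  by_cases hn : IsLarge n
  · rw [smallLoss, if_pos hn, sub_zero]
    have hM : Integrable (fun ω => ⨆ i, X i ω) ν := by
      refine integrable_of_forall_exists_eq hX hmap hint (.iSup hX) fun ω => ?_
      obtain ⟨i, hi⟩ := exists_eq_ciSup_of_finite (f := fun i => X i ω)
      exact ⟨i, hi.symm⟩
    refine mul_integral_le_of_forall_real (by norm_num)
      (hpos.mono fun ω h => Real.iSup_nonneg h) hR0 hM hR fun t => ?_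
    have hn3 : (3 : ℝ) ≤ n := by exact_mod_cast hn.1
    -- As α₁ lies between 2 and 3, n ≥ 3 is what makes α₁/n a probability.
    have hq : ∀ a : ℝ, 0 < a → a ≤ 3 → μ.real (Set.Ici (quantile μ (1 - a / n))) = a / n :=
      fun a ha ha3 => real_Ici_quantile h0 hc (by positivity)
        ((div_le_one (by linarith)).2 (by linarith))
    calc _ ≤ 0.869 * (1 - (1 - μ.real (Set.Ici t)) ^ n) := by
          gcongr
          exact real_le_iSup_le hX hind hmap t
      _ ≤ _ := (isIIDUpTo_extendByZero hX hind hmap).mul_one_sub_pow_le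
          (τ := quantileThreshold μ n) hn (hq _ (by norm_num) (by norm_num))
          (hq _ (by norm_num) (by norm_num)) (hq _ (by norm_num) (by norm_num)) t
      _ ≤ _ := by
          refine measureReal_mono (fun ω hω => ?_) (measure_ne_top _ _)
          have h := process_snd_eq_selected (hτ := quantileThreshold_nonneg μ n)
            (fun i => X i ω) (fun m => extendByZero X m ω)
            (fun i => by rw [extendByZero_of_lt i.2]) hω.1
          exact hω.2.trans h.le
  -- The factor demanded is 0, and the reward is nonnegative.
  · rw [smallLoss, if_neg hn, sub_self, zero_mul]
    exact integral_nonneg_of_ae hR0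

end ThresholdTesting

end

theorem theorem4 :
    ∃ (P : Program) (C : ℕ) (ε : ℕ → ℝ), Tendsto ε atTop (𝓝 0) ∧
      ∀ n : ℕ, 1 ≤ n → ∀ (μ : Measure ℝ) [IsProbabilityMeasure μ], μ (Set.Iio 0) = 0 →
        Integrable (fun x : ℝ => x) μ → Continuous (cdf μ) →
        ∃ A : TestingAlgorithm n,
          P.Implements μ A (C * n) ∧
          (3 ≤ n → A.IsQuantileTesting μ ![2.035135, 0.5063, 0.05701]) ∧
          TestingAlgorithm.IsCompetitive.{u} A μ (0.869 - ε n) := by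
  refine ⟨threeThresholds 2.035135 0.5063 0.05701, 27, smallLoss, tendsto_smallLoss, ?_⟩
  intro n hn μ _ h0 hint hc
  have : NeZero n := ⟨by omega⟩
  refine ⟨sequentialTesting 3 n (quantileThreshold μ n) (quantileThreshold_nonneg μ n), ?_, ?_,
    isCompetitive_quantileThreshold h0 hint hc⟩
  · refine implements_threeThresholds μ ?_ ?_ fun j hj => ?_
    · simp [quantileThreshold]
    · simp [quantileThreshold]
    · obtain ⟨j, rfl⟩ : ∃ m, j = m + 2 := ⟨j - 2, by omega⟩
      simp [quantileThreshold]
  · intro _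
    refine isQuantileTesting_sequentialTesting μ _ fun j hj => ?_
    interval_cases j <;> rfl
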